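/- Let $n\ge 4$ and $1<k<n-1$ be integers. Let $\tau=(1\,2\,\dots\,n)\in S_n$, let $\varphi\in S_n$ be the permutation with $\varphi(i)=k+1-i$ for $1\le i\le k$ and $\varphi(i)=i$ for $k<i\le n$, and let $OT_{n,k}=\langle\tau,\varphi\rangle\le S_n$ be the oval track group. Let $PS_n$ be the parity subgroup of $S_n$, consisting of the permutations that either map odd numbers to odd numbers and even numbers to even numbers, or map odd numbers to even numbers and even numbers to odd numbers. For even $n$, let $S^{\mathrm{odd}}_{n/2}$, $A^{\mathrm{odd}}_{n/2}$ (respectively $S^{\mathrm{even}}_{n/2}$, $A^{\mathrm{even}}_{n/2}$) be the symmetric and alternating groups on the odd (respectively even) numbers in $\{1,\dots,n\}$, and regard $S^{\mathrm{odd}}_{n/2}\times S^{\mathrm{even}}_{n/2}$ and $A^{\mathrm{odd}}_{n/2}\times A^{\mathrm{even}}_{n/2}$ as subgroups of $S_n$, acting on $\{1,\dots,n\}$ in the natural way. Then the following equalities of subsets of $S_n$ hold. 1. $OT_{n,k}=S_n$ if $n$ and $k$ are both even, or if $n$ is odd and $k\equiv 2,3\pmod 4$. 2. $OT_{n,k}=A_n$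 if $n$ is odd and $k\equiv 0,1\pmod 4$. 3. $OT_{n,k}=PS_n$ if $n$ is even and $k\equiv 3\pmod 4$. 4. $OT_{n,k}=\{\alpha,\tau\alpha \mid \alpha\in (S^{\mathrm{odd}}_{n/2}\times S^{\mathrm{even}}_{n/2})\cap A_n\}$ if $n$ is even and $k\equiv 5\pmod 8$, or if $n\equiv 0\pmod 4$ and $k\equiv 1\pmod 8$. 5. $OT_{n,k}=\{\alpha,\tau\alpha \mid \alpha\in A^{\mathrm{odd}}_{n/2}\times A^{\mathrm{even}}_{n/2}\}$ if $n\equiv 2\pmod 4$ and $k\equiv 1\pmod 8$. -/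

import Mathlib

namespace OvalTrack

/-- The number of a tile. The tiles `1, …, n` are represented by `Fin n`, and the element `i`
of `Fin n` stands for the tile with number `i + 1`. -/
def tile {n : ℕ} (i : Fin n) : ℕ := (i : ℕ) + 1

/-- The translation `τ = (1 2 … n)`. -/
def translation (n : ℕ) : Equiv.Perm (Fin n) := finRotate n

/-- The underlying map of the flip: tile `j` goes to tile `k + 1 - j` when `j ≤ k`, and is fixed
when `j > k`. In terms of `i = j - 1`, the value `i < k` goes to `k - 1 - i`. -/
def flipFun (n k : ℕ) (hk : k ≤ n) (i : Fin n) : Fin n :=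
  if (i : ℕ) < k then ⟨k - 1 - i, by have := i.isLt; omega⟩ else i

theorem flipFun_involutive (n k : ℕ) (hk : k ≤ n) : Function.Involutive (flipFun n k hk) := by
  intro i
  apply Fin.ext
  unfold flipFun
  split_ifs <;> simp at * <;> omega

/-- The flip `φ = (1 k)(2 k-1)…`, reversing the tiles `1, …, k`. -/
def flipMove (n k : ℕ) (hk : k ≤ n) : Equiv.Perm (Fin n) :=
  (flipFun_involutive n k hk).toPerm

/-- The oval track group `OT_{n,k} = ⟨τ, φ⟩`. -/
def ovalTrackGroup (n k : ℕ) (hk : k ≤ n) : Subgroup (Equiv.Perm (Fin n)) :=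
  Subgroup.closure {translation n, flipMove n k hk}

/-- Type I permutations send odd tiles to odd tiles and even tiles to even tiles. -/
def IsTypeI {n : ℕ} (θ : Equiv.Perm (Fin n)) : Prop :=
  ∀ i, Odd (tile (θ i)) ↔ Odd (tile i)

/-- Type II permutations send odd tiles to even tiles and even tiles to odd tiles. -/
def IsTypeII {n : ℕ} (θ : Equiv.Perm (Fin n)) : Prop :=
  ∀ i, Odd (tile (θ i)) ↔ Even (tile i)

/-- The parity subgroup `PS_n`: the permutations that are of Type I or of Type II.
(For odd `n` there are no Type II permutations.) -/
def paritySubgroup (n : ℕ) : Subgroup (Equiv.Perm (Fin n)) where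
  carrier := {θ | IsTypeI θ ∨ IsTypeII θ}
  one_mem' := Or.inl fun _ => Iff.rfl
  mul_mem' := by
    rintro a b (ha | ha) (hb | hb)
    · exact Or.inl fun i => (ha (b i)).trans (hb i)
    · exact Or.inr fun i => (ha (b i)).trans (hb i)
    · refine Or.inr fun i => (ha (b i)).trans ?_
      rw [← Nat.not_odd_iff_even, ← Nat.not_odd_iff_even, hb i]
    · refine Or.inl fun i => (ha (b i)).trans ?_
      rw [← Nat.not_odd_iff_even, hb i, Nat.not_even_iff_odd]
  inv_mem' := by
    rintro a (ha | ha)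
    · refine Or.inl fun i => ?_
      have h := ha (a.symm i)
      rw [Equiv.apply_symm_apply] at h
      exact h.symm
    · refine Or.inr fun i => ?_
      have h := ha (a.symm i)
      rw [Equiv.apply_symm_apply] at h
      rw [← Nat.not_odd_iff_even, h, Nat.not_even_iff_odd]
      exact Iff.rfl

/-- The odd tiles. -/
abbrev OddTile (n : ℕ) : Type := {i : Fin n // Odd (tile i)}

/-- The even tiles. -/
abbrev EvenTile (n : ℕ) : Type := {i : Fin n // ¬ Odd (tile i)}

/-- The homomorphism that lets a permutation of the odd tiles and a permutation of the even tiles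
act together on all tiles. -/
def oddEvenHom (n : ℕ) :
    Equiv.Perm (OddTile n) × Equiv.Perm (EvenTile n) →* Equiv.Perm (Fin n) :=
  Equiv.Perm.subtypeCongrHom fun i : Fin n => Odd (tile i)

/-- `S^odd × S^even` as a subgroup of `S_n`. -/
def symOddEven (n : ℕ) : Subgroup (Equiv.Perm (Fin n)) := (oddEvenHom n).range

/-- `A^odd × A^even` as a subgroup of `S_n`. -/
def altOddEven (n : ℕ) : Subgroup (Equiv.Perm (Fin n)) :=
  ((alternatingGroup (OddTile n)).prod (alternatingGroup (EvenTile n))).map (oddEvenHom n)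

end OvalTrack

open OvalTrack

/-! Conjugating `φ` by powers of `τ` puts every reversal of `k` consecutive tiles in the group. Four
such reversals multiply to a 3-cycle on the positions `2`, `0`, `k + 1`, counted from `0`
(`reversal_mul_eq_threeCycle`); its `τ`-conjugates involve `j + 2`, `j`, `j + k + 1` modulo `n`.
Conjugates for `j`, `j + 2`, `j + 4`, … form an overlapping chain, so all 3-cycles on the union of
their supports are present (`allThreeCyclesMem_cyclicTile`).

If `n` is odd or `k` is even, that union is everything and the group contains `A_n`; the signs of
`τ` and `φ` decide between `A_n` and `S_n`. In general the chains contain all odd tiles and all even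
tiles respectively, so the group contains `A^odd × A^even` (`altOddEven_le_ovalTrackGroup`). For `n`
even and `k` odd, `φ` and `τ²` preserve the two classes while `τ` exchanges them, and only the pairs
of signs that `φ` and `τ²` induce on the classes remain to be computed. -/

namespace OvalTrack

open Equiv Equiv.Perm

/-! ### Generating all 3-cycles from overlapping ones. -/

section ThreeCycles

variable {α : Type*} [DecidableEq α]

/-- The points `a`, `b`, `c` are distinct and the 3-cycle `(a b c)` lies in `H`. -/
def ThreeCycleMem (H : Subgroup (Perm α)) (a b c : α) : Prop :=
  a ≠ b ∧ b ≠ c ∧ a ≠ c ∧ swap a b * swap b c ∈ H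

namespace ThreeCycleMem

variable {H : Subgroup (Perm α)} {a b c d : α}

theorem rotate (h : ThreeCycleMem H a b c) : ThreeCycleMem H b c a := by
  obtain ⟨ab, bc, ac, hm⟩ := h
  refine ⟨bc, ac.symm, ab.symm, ?_⟩
  convert hm using 1
  ext x
  simp only [Perm.mul_apply, swap_apply_def]
  grind

theorem reverse (h : ThreeCycleMem H a b c) : ThreeCycleMem H c b a := by
  obtain ⟨ab, bc, ac, hm⟩ := h
  refine ⟨bc.symm, ab.symm, ac.symm, ?_⟩
  simpa [swap_comm] using H.inv_mem hm

theorem conj (h : ThreeCycleMem H a b c) {g : Perm α} (hg : g ∈ H) :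
    ThreeCycleMem H (g a) (g b) (g c) := by
  obtain ⟨ab, bc, ac, hm⟩ := h
  refine ⟨g.injective.ne ab, g.injective.ne bc, g.injective.ne ac, ?_⟩
  have := H.mul_mem (H.mul_mem hg hm) (H.inv_mem hg)
  rw [swap_apply_apply, swap_apply_apply]
  convert this using 1
  group

theorem swap_left (h : ThreeCycleMem H a b c) : ThreeCycleMem H b a c :=
  h.reverse.rotate

theorem trans (h : ThreeCycleMem H a b c) (h' : ThreeCycleMem H b c d) (had : a ≠ d) :
    ThreeCycleMem H a b d := by
  obtain ⟨ab, bc, ac, -⟩ := id h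
  obtain ⟨-, cd, bd, hm⟩ := id h'
  -- The square of `(b c d)` fixes `a` and sends `b` to `d` and `c` to `b`, so it conjugates `(a b
  -- c)` to `(a d b)`, the inverse of the desired cycle.
  have := h.conj (H.mul_mem hm hm)
  rw [show (swap b c * swap c d * (swap b c * swap c d)) a = a by
      simp only [Perm.mul_apply, swap_apply_def]; grind,
    show (swap b c * swap c d * (swap b c * swap c d)) b = d by
      simp only [Perm.mul_apply, swap_apply_def]; grind,
    show (swap b c * swap c d * (swap b c * swap c d)) c = b by
      simp only [Perm.mul_apply, swap_apply_def]; grind] at this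
  exact this.reverse.rotate.rotate

end ThreeCycleMem

/-- All 3-cycles on points of `S` lie in `H`. -/
def AllThreeCyclesMem (H : Subgroup (Perm α)) (S : Set α) : Prop :=
  ∀ a ∈ S, ∀ b ∈ S, ∀ c ∈ S, a ≠ b → b ≠ c → a ≠ c → ThreeCycleMem H a b c

namespace AllThreeCyclesMem

variable {H : Subgroup (Perm α)} {S : Set α}

theorem of_threeCycleMem {a b c : α} (h : ThreeCycleMem H a b c) :
    AllThreeCyclesMem H {a, b, c} := by
  have h1 := h.rotate
  have h2 := h1.rotate
  have h3 := h.reverse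
  have h4 := h1.reverse
  have h5 := h2.reverse
  intro x hx y hy z hz xy yz xz
  simp only [Set.mem_insert_iff, Set.mem_singleton_iff] at hx hy hz
  rcases hx with rfl | rfl | rfl <;> rcases hy with rfl | rfl | rfl <;>
    rcases hz with rfl | rfl | rfl <;> first | contradiction | assumption

/-- Two uses of `trans` replace `x` and `y` by arbitrary points: `(s x y)` and `(x y w)` give `(s x
w)`, then `(t s x)` and `(s x w)` give `(t s w)`. -/
theorem insert {x y w : α} (hS : AllThreeCyclesMem H S) (hx : x ∈ S) (hy : y ∈ S)
    (h : ThreeCycleMem H x y w) : AllThreeCyclesMem H (Insert.insert w S) := by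
  by_cases hw : w ∈ S
  · rwa [Set.insert_eq_of_mem hw]
  have hxw : ∀ s ∈ S, s ≠ x → ThreeCycleMem H s x w := by
    intro s hs hsx
    by_cases hsy : s = y
    · subst hsy
      exact h.swap_left
    · exact (hS s hs x hx y hy hsx h.1 hsy).trans h (by rintro rfl; exact hw hs)
  have key : ∀ s ∈ S, ∀ t ∈ S, s ≠ t → ThreeCycleMem H s t w := by
    intro s hs t ht hst
    by_cases hsx : s = x
    · subst hsx
      exact (hxw t ht hst.symm).swap_left
    · by_cases htx : t = x
      · subst htx
        exact hxw s hs hst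
      · exact ((hS t ht s hs x hx hst.symm hsx htx).trans (hxw s hs hsx)
          (by rintro rfl; exact hw ht)).swap_left
  rintro a ha b hb c hc ab bc ac
  rcases ha with rfl | ha
  · have hb := hb.resolve_left ab.symm
    have hc := hc.resolve_left ac.symm
    exact (key b hb c hc bc).rotate.rotate
  rcases hb with rfl | hb
  · exact (key c (hc.resolve_left bc.symm) a ha ac.symm).rotate
  rcases hc with rfl | hc
  · exact key a ha b hb ab
  · exact hS a ha b hb c hc ab bc ac

/-- One shared point suffices. If `y` and `z` are both new, `(x y z)` fixes two other points `s`,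
`t` of `S` and conjugates `(s t x)` to `(s t y)`; this adds `y`, after which `(x y z)` has two
points in the enlarged set. -/
theorem insert_insert {x y z : α} (hS : AllThreeCyclesMem H S)
    (hcard : ∀ u, ∃ s ∈ S, ∃ t ∈ S, s ≠ t ∧ s ≠ u ∧ t ≠ u) (hx : x ∈ S)
    (h : ThreeCycleMem H x y z) :
    AllThreeCyclesMem H (Insert.insert y (Insert.insert z S)) := by
  rw [Set.insert_comm]
  by_cases hy : y ∈ S
  · rw [Set.insert_eq_of_mem hy]
    exact hS.insert hx hy h
  by_cases hz : z ∈ S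
  · rw [Set.insert_eq_of_mem (Set.mem_insert_of_mem _ hz)]
    exact hS.insert hx hz h.reverse.rotate.rotate
  obtain ⟨s, hs, t, ht, hst, hsx, htx⟩ := hcard x
  have hys : ThreeCycleMem H s t y := by
    have := (hS s hs t ht x hx hst htx hsx).conj h.2.2.2
    have ne : ∀ u ∈ S, u ≠ x → (swap x y * swap y z) u = u := by
      intro u hu hux
      have huy : u ≠ y := by rintro rfl; exact hy hu
      have huz : u ≠ z := by rintro rfl; exact hz hu
      rw [Perm.mul_apply, swap_apply_of_ne_of_ne huy huz, swap_apply_of_ne_of_ne hux huy]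
    rwa [ne s hs hsx, ne t ht htx, Perm.mul_apply,
      swap_apply_of_ne_of_ne h.1 h.2.2.1, swap_apply_left] at this
  exact (hS.insert hs ht hys).insert (Set.mem_insert_of_mem _ hx) (Set.mem_insert _ _) h

/-- If `H` contains the images of all 3-cycles, it contains the image of the alternating group. -/
theorem map_alternatingGroup_le {β : Type*} [Fintype β] [DecidableEq β]
    (hS : AllThreeCyclesMem H S) (f : Perm β →* Perm α) (e : β → α) (he : e.Injective)
    (heS : ∀ b, e b ∈ S) (hf : ∀ a b, f (swap a b) = swap (e a) (e b)) :
    (alternatingGroup β).map f ≤ H := by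
  rw [← closure_three_cycles_eq_alternating, Subgroup.map_le_iff_le_comap, Subgroup.closure_le]
  intro g hg
  have h3 : g.IsThreeCycle := hg
  obtain ⟨a, ha⟩ : g.support.Nonempty := by
    rw [← Finset.card_pos, h3.card_support]; norm_num
  have nd := h3.nodup_iff_mem_support.2 ha
  simp only [List.nodup_cons, List.mem_cons, not_or, List.not_mem_nil] at nd
  rw [SetLike.mem_coe, Subgroup.mem_comap, h3.eq_swap_mul_swap_iff_mem_support.2 ha, map_mul,
    hf, hf]
  exact (hS _ (heS _) _ (heS _) _ (heS _) (he.ne nd.1.1) (he.ne nd.2.1.1)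
    (he.ne nd.1.2.1)).2.2.2

end AllThreeCyclesMem

end ThreeCycles

/-- The elements of `⟨t, f⟩`, when `f` lies in a subgroup `N` normalized by `t` with `t² ∈ N`
and `N ≤ ⟨t, f⟩`. -/
theorem closure_pair_eq_union_coset {G : Type*} [Group G] {N : Subgroup G} {t f : G}
    (hconj : ∀ a ∈ N, t * a * t⁻¹ ∈ N) (ht : t * t ∈ N) (hf : f ∈ N)
    (hN : N ≤ Subgroup.closure {t, f}) :
    (Subgroup.closure {t, f} : Set G) = {g | ∃ a ∈ N, g = a ∨ g = t * a} := by
  -- Here `t⁻¹ a t = t⁻² (t a t⁻¹) t²`.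
  have hconj' : ∀ a ∈ N, t⁻¹ * a * t ∈ N := by
    intro a ha
    have := N.mul_mem (N.mul_mem (N.inv_mem ht) (hconj a ha)) ht
    convert this using 1
    group
  ext g
  constructor
  · intro hg
    induction hg using Subgroup.closure_induction with
    | mem x hx =>
      rcases hx with rfl | rfl
      · exact ⟨1, N.one_mem, Or.inr (mul_one _).symm⟩
      · exact ⟨_, hf, Or.inl rfl⟩
    | one => exact ⟨1, N.one_mem, Or.inl rfl⟩
    | mul x y _ _ hx hy =>
      obtain ⟨a, ha, rfl | rfl⟩ := hx <;> obtain ⟨b, hb, rfl | rfl⟩ := hy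
      · exact ⟨_, N.mul_mem ha hb, Or.inl rfl⟩
      · exact ⟨_, N.mul_mem (hconj' _ ha) hb, Or.inr (by group)⟩
      · exact ⟨_, N.mul_mem ha hb, Or.inr (mul_assoc _ _ _)⟩
      · exact ⟨_, N.mul_mem (N.mul_mem ht (hconj' a ha)) hb, Or.inl (by group)⟩
    | inv x _ hx =>
      obtain ⟨a, ha, rfl | rfl⟩ := hx
      · exact ⟨_, N.inv_mem ha, Or.inl rfl⟩
      · exact ⟨_, N.mul_mem (N.inv_mem ht) (hconj _ (N.inv_mem ha)), Or.inr (by group)⟩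
  · have htm : t ∈ Subgroup.closure {t, f} := Subgroup.subset_closure (Set.mem_insert _ _)
    rintro ⟨a, ha, rfl | rfl⟩
    · exact hN ha
    · exact Subgroup.mul_mem _ htm (hN ha)

/-! ### Reversals of intervals and the sign of the flip. -/

theorem val_translation {n : ℕ} (i : Fin n) :
    (translation n i : ℕ) = if (i : ℕ) + 1 = n then (0 : ℕ) else (i : ℕ) + 1 := by
  obtain _ | n := n
  · exact i.elim0
  rw [translation, coe_finRotate (n := n)]
  simp only [Fin.ext_iff, Fin.val_last, Nat.add_right_cancel_iff]

theorem val_flipMove {n k : ℕ} (hk : k ≤ n) (i : Fin n) :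
    (flipMove n k hk i : ℕ) = if (i : ℕ) < k then k - 1 - i else i := by
  change (flipFun n k hk i : ℕ) = _
  unfold flipFun
  split_ifs <;> rfl

/-- The reversal of the interval `[s, s + k)` as a map. -/
def reversalFun (n s k : ℕ) (h : s + k ≤ n) (i : Fin n) : Fin n :=
  if hi : s ≤ (i : ℕ) ∧ (i : ℕ) < s + k then ⟨2 * s + k - 1 - i, by omega⟩ else i

theorem val_reversalFun {n s k : ℕ} (h : s + k ≤ n) (i : Fin n) :
    (reversalFun n s k h i : ℕ) =
      if s ≤ (i : ℕ) ∧ (i : ℕ) < s + k then 2 * s + k - 1 - i else i := by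
  unfold reversalFun
  split_ifs <;> rfl

theorem reversalFun_involutive (n s k : ℕ) (h : s + k ≤ n) :
    Function.Involutive (reversalFun n s k h) := by
  intro i
  apply Fin.ext
  simp only [val_reversalFun]
  split_ifs <;> omega

/-- The reversal of the interval `[s, s + k)`. -/
def reversal (n s k : ℕ) (h : s + k ≤ n) : Perm (Fin n) :=
  (reversalFun_involutive n s k h).toPerm

theorem val_reversal {n s k : ℕ} (h : s + k ≤ n) (i : Fin n) :
    (reversal n s k h i : ℕ) =
      if s ≤ (i : ℕ) ∧ (i : ℕ) < s + k then 2 * s + k - 1 - i else i :=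
  val_reversalFun h i

theorem reversal_zero {n k : ℕ} (h : k ≤ n) :
    reversal n 0 k ((Nat.zero_add k).le.trans h) = flipMove n k h := by
  ext i
  rw [val_reversal, val_flipMove]
  split_ifs <;> omega

theorem translation_conj_reversal {n s k : ℕ} (h : s + 1 + k ≤ n) :
    translation n * reversal n s k (by omega) * (translation n)⁻¹ = reversal n (s + 1) k h := by
  rw [mul_inv_eq_iff_eq_mul]
  ext i
  simp only [Perm.mul_apply, val_reversal, val_translation]
  have := i.isLt
  split_ifs <;> omega

theorem sign_flipMove {n : ℕ} (k : ℕ) (hk : k ≤ n) :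
    sign (flipMove n k hk) = (-1) ^ (k / 2) := by
  induction k using Nat.twoStepInduction with
  | zero =>
    rw [show flipMove n 0 hk = 1 by ext i; simp [val_flipMove]]
    simp
  | one =>
    rw [show flipMove n 1 hk = 1 by
      ext i; simp only [val_flipMove, Perm.one_apply]; split_ifs <;> omega]
    simp
  | more k ih _ =>
    -- Peeling off the outermost transposition leaves a reversal of length `k`, which is conjugate
    -- to the shorter flip.
    have : flipMove n (k + 2) hk =
        swap ⟨0, by omega⟩ ⟨k + 1, by omega⟩ * reversal n 1 k (by omega) := by
      ext i
      simp only [val_flipMove, Perm.mul_apply, swap_apply_def, Fin.ext_iff, val_reversal,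
        apply_ite Fin.val]
      split_ifs <;> omega
    rw [this, ← translation_conj_reversal (s := 0) (by omega), reversal_zero (by omega), Perm.sign_mul,
      Perm.sign_mul, Perm.sign_mul, sign_inv, ih (by omega), sign_swap (by simp [Fin.ext_iff]),
      mul_right_comm (sign (translation n)), Int.units_mul_self, one_mul,
      Nat.add_div_right k two_pos, pow_succ, mul_comm]

/-! ### Three-cycles and alternating groups inside the oval track group. -/

section Generators

variable {n k : ℕ} {hk : k ≤ n}

theorem translation_mem : translation n ∈ ovalTrackGroup n k hk :=
  Subgroup.subset_closure (Set.mem_insert _ _)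

theorem flipMove_mem : flipMove n k hk ∈ ovalTrackGroup n k hk :=
  Subgroup.subset_closure (Set.mem_insert_of_mem _ rfl)

theorem reversal_mem {s : ℕ} (h : s + k ≤ n) : reversal n s k h ∈ ovalTrackGroup n k hk := by
  induction s with
  | zero => rw [reversal_zero hk]; exact flipMove_mem
  | succ s ih =>
    rw [← translation_conj_reversal]
    exact Subgroup.mul_mem _ (Subgroup.mul_mem _ translation_mem (ih _))
      (Subgroup.inv_mem _ translation_mem)

/-- The first two factors form the cyclic shift by `2` on `{1, …, k + 1}`, the last two the cyclic
shift by `-2` on `{0, …, k}`. They cancel except at `2 ↦ 0 ↦ k + 1 ↦ 2`. -/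
theorem reversal_mul_eq_threeCycle (hk : 2 ≤ k) (h : 2 + k ≤ n) :
    reversal n 2 k h * reversal n 1 k (by omega) * reversal n 0 k (by omega) *
      reversal n 1 k (by omega) =
    swap ⟨2, by omega⟩ ⟨0, by omega⟩ * swap ⟨0, by omega⟩ ⟨k + 1, by omega⟩ := by
  ext i
  simp only [Perm.mul_apply, swap_apply_def, Fin.ext_iff, apply_ite Fin.val]
  have h₁ := val_reversal (s := 1) (k := k) (by omega) i
  generalize reversal n 1 k _ i = x at *
  have h₂ := val_reversal (s := 0) (k := k) (by omega) x
  generalize reversal n 0 k _ x = y at *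
  have h₃ := val_reversal (s := 1) (k := k) (by omega) y
  generalize reversal n 1 k _ y = z at *
  rw [val_reversal]
  split_ifs at h₁ <;> split_ifs at h₂ <;> split_ifs at h₃ <;> split_ifs <;> first | omega | contradiction

/-- The tile in position `j` modulo `n`, counted from `0`. -/
def cyclicTile (n : ℕ) (hn : 0 < n) (j : ℕ) : Fin n := ⟨j % n, Nat.mod_lt _ hn⟩

theorem translation_cyclicTile (hn : 0 < n) (j : ℕ) :
    translation n (cyclicTile n hn j) = cyclicTile n hn (j + 1) := by
  ext
  rw [val_translation]
  change (if j % n + 1 = n then 0 else j % n + 1) = (j + 1) % n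
  have hj := Nat.mod_lt j hn
  rw [← Nat.mod_add_mod]
  split_ifs with h
  · rw [h, Nat.mod_self]
  · exact (Nat.mod_eq_of_lt (by omega)).symm

theorem threeCycleMem_cyclicTile (hk2 : 2 ≤ k) (h : 2 + k ≤ n) (hn : 0 < n) (j : ℕ) :
    ThreeCycleMem (ovalTrackGroup n k hk) (cyclicTile n hn (2 + j)) (cyclicTile n hn j)
      (cyclicTile n hn (k + 1 + j)) := by
  induction j with
  | zero =>
    have e : ∀ j (hj : j < n), cyclicTile n hn j = ⟨j, hj⟩ :=
      fun j hj => Fin.ext (Nat.mod_eq_of_lt hj)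
    simp only [Nat.add_zero]
    rw [e 2 (by omega), e 0 hn, e (k + 1) (by omega)]
    refine ⟨by simp, by simp [Fin.ext_iff], by simp only [ne_eq, Fin.ext_iff]; omega, ?_⟩
    rw [← reversal_mul_eq_threeCycle hk2 h]
    exact Subgroup.mul_mem _ (Subgroup.mul_mem _ (Subgroup.mul_mem _ (reversal_mem _)
      (reversal_mem _)) (reversal_mem _)) (reversal_mem _)
  | succ j ih =>
    have := ih.conj translation_mem
    simpa only [translation_cyclicTile, Nat.add_assoc] using this

/-- All 3-cycles on the tiles in the positions `2l + j` and `2l + k + 1 + j` modulo `n` lie in the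
oval track group. -/
theorem allThreeCyclesMem_cyclicTile (hk2 : 2 ≤ k) (h : 2 + k ≤ n) (hn : 0 < n) (j : ℕ) :
    AllThreeCyclesMem (ovalTrackGroup n k hk)
      {x | ∃ l, x = cyclicTile n hn (2 * l + j) ∨ x = cyclicTile n hn (k + 1 + (2 * l + j))} := by
  set T : ℕ → Fin n := cyclicTile n hn with hT
  have hC := threeCycleMem_cyclicTile (hk := hk) hk2 h hn
  -- The cycles based at `2 * l + j` and `2 * (l + 1) + j` share the point `2 * (l + 1) + j`, so
  -- `insert_insert` extends the chain one link at a time.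
  have step : ∀ m, ∃ S : Set (Fin n), AllThreeCyclesMem (ovalTrackGroup n k hk) S ∧
      ∀ l ≤ m, T (2 + (2 * l + j)) ∈ S ∧ T (2 * l + j) ∈ S ∧ T (k + 1 + (2 * l + j)) ∈ S := by
    intro m
    induction m with
    | zero =>
      refine ⟨_, .of_threeCycleMem (hC j), ?_⟩
      intro l hl
      obtain rfl : l = 0 := by omega
      simp [hT]
    | succ m ih =>
      obtain ⟨S, hS, hm⟩ := ih
      have hcard : ∀ u, ∃ s ∈ S, ∃ t ∈ S, s ≠ t ∧ s ≠ u ∧ t ≠ u := by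
        intro u
        obtain ⟨ha, hb, hc⟩ := hm 0 (Nat.zero_le _)
        obtain ⟨ab, bc, ac, -⟩ := hC (2 * 0 + j)
        by_cases hu : T (2 + (2 * 0 + j)) = u
        · exact ⟨_, hb, _, hc, bc, hu ▸ ab.symm, hu ▸ ac.symm⟩
        · by_cases hu' : T (2 * 0 + j) = u
          · exact ⟨_, ha, _, hc, ac, hu, hu' ▸ bc.symm⟩
          · exact ⟨_, ha, _, hb, ab, hu, hu'⟩
      have hx := (hm m le_rfl).1
      rw [show 2 + (2 * m + j) = 2 * (m + 1) + j by ring] at hx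
      refine ⟨_, hS.insert_insert hcard hx (hC (2 * (m + 1) + j)).swap_left, ?_⟩
      intro l hl
      rcases Nat.lt_or_ge l (m + 1) with hl' | hl'
      · obtain ⟨h1, h2, h3⟩ := hm l (by omega)
        exact ⟨.inr (.inr h1), .inr (.inr h2), .inr (.inr h3)⟩
      · obtain rfl : l = m + 1 := by omega
        exact ⟨.inl rfl, .inr (.inr hx), .inr (.inl rfl)⟩
  rintro x ⟨l, hx⟩ y ⟨l', hy⟩ z ⟨l'', hz⟩
  obtain ⟨S, hS, hm⟩ := step (l + l' + l'')
  have h1 := (hm l (by omega)).2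
  have h2 := (hm l' (by omega)).2
  have h3 := (hm l'' (by omega)).2
  refine hS x ?_ y ?_ z ?_
  · rcases hx with rfl | rfl; exacts [h1.1, h1.2]
  · rcases hy with rfl | rfl; exacts [h2.1, h2.2]
  · rcases hz with rfl | rfl; exacts [h3.1, h3.2]

theorem alternatingGroup_le_ovalTrackGroup (hk2 : 2 ≤ k) (h : 2 + k ≤ n)
    (hp : Odd n ∨ Even k) : alternatingGroup (Fin n) ≤ ovalTrackGroup n k hk := by
  have hn : 0 < n := by omega
  have := (allThreeCyclesMem_cyclicTile (hk := hk) hk2 h hn 0).map_alternatingGroup_le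
    (MonoidHom.id (Perm (Fin n))) id Function.injective_id ?_ (fun _ _ => rfl)
  · rwa [Subgroup.map_id] at this
  · intro b
    have hb := b.isLt
    rcases Nat.even_or_odd' (b : ℕ) with ⟨l, hl | hl⟩
    · exact ⟨l, .inl (Fin.ext ((Nat.mod_eq_of_lt (by omega)).trans (by simp [hl])).symm)⟩
    · rcases hp with ⟨m, hm⟩ | ⟨m, hm⟩
      -- For `n` odd, an odd position `b` is reached by the even number `b + n`.
      · refine ⟨l + m + 1, .inl (Fin.ext ?_)⟩
        change (b : ℕ) = (2 * (l + m + 1) + 0) % n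
        rw [show 2 * (l + m + 1) + 0 = b + n by omega, Nat.add_mod_right, Nat.mod_eq_of_lt hb]
      -- For `k` even, `k + 1` is odd and changes the parity; adding `2 * n` keeps the subtraction
      -- of `m = k / 2` from truncating.
      · refine ⟨l + n - m, .inr (Fin.ext ?_)⟩
        change (b : ℕ) = (k + 1 + (2 * (l + n - m) + 0)) % n
        rw [show k + 1 + (2 * (l + n - m) + 0) = b + n * 2 by omega, Nat.add_mul_mod_self_left,
          Nat.mod_eq_of_lt hb]

theorem oddEvenHom_inl_swap (a b : OddTile n) :
    oddEvenHom n (swap a b, 1) = swap (a : Fin n) b := by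
  change Perm.subtypeCongr (swap a b) 1 = _
  ext x
  rw [Perm.subtypeCongr.apply]
  split_ifs with hx
  · simp only [swap_apply_def, Subtype.ext_iff]
    split_ifs <;> rfl
  · rw [swap_apply_of_ne_of_ne]
    · rfl
    · rintro rfl; exact hx a.2
    · rintro rfl; exact hx b.2

theorem oddEvenHom_inr_swap (a b : EvenTile n) :
    oddEvenHom n (1, swap a b) = swap (a : Fin n) b := by
  change Perm.subtypeCongr 1 (swap a b) = _
  ext x
  rw [Perm.subtypeCongr.apply]
  split_ifs with hx
  · rw [swap_apply_of_ne_of_ne]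
    · rfl
    · rintro rfl; exact a.2 hx
    · rintro rfl; exact b.2 hx
  · simp only [swap_apply_def, Subtype.ext_iff]
    split_ifs <;> rfl

theorem altOddEven_le_ovalTrackGroup (hk2 : 2 ≤ k) (h : 2 + k ≤ n) :
    altOddEven n ≤ ovalTrackGroup n k hk := by
  have hn : 0 < n := by omega
  have hodd := (allThreeCyclesMem_cyclicTile (hk := hk) hk2 h hn 0).map_alternatingGroup_le
    ((oddEvenHom n).comp (MonoidHom.inl _ _)) Subtype.val Subtype.val_injective ?_
    oddEvenHom_inl_swap
  · have heven := (allThreeCyclesMem_cyclicTile (hk := hk) hk2 h hn 1).map_alternatingGroup_le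
      ((oddEvenHom n).comp (MonoidHom.inr _ _)) Subtype.val Subtype.val_injective ?_
      oddEvenHom_inr_swap
    · rintro _ ⟨⟨a, b⟩, ⟨ha, hb⟩, rfl⟩
      rw [show (a, b) = (a, 1) * (1, b) by simp, map_mul]
      exact Subgroup.mul_mem _ (hodd ⟨a, ha, rfl⟩) (heven ⟨b, hb, rfl⟩)
    · rintro ⟨b, hb⟩
      rw [Nat.not_odd_iff_even] at hb
      obtain ⟨l, hl⟩ := hb
      unfold tile at hl
      exact ⟨l - 1, .inl (Fin.ext ((Nat.mod_eq_of_lt (by omega)).trans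
        (by simp only; omega)).symm)⟩
  · rintro ⟨b, l, hl⟩
    unfold tile at hl
    exact ⟨l, .inl (Fin.ext ((Nat.mod_eq_of_lt (by omega)).trans (by simp only; omega)).symm)⟩

end Generators

/-! ### Signs on the odd and even tiles. -/

section Parity

variable {n : ℕ}

theorem oddEvenHom_apply (a : Perm (OddTile n)) (b : Perm (EvenTile n)) (i : Fin n) :
    oddEvenHom n (a, b) i = if h : Odd (tile i) then (a ⟨i, h⟩ : Fin n) else b ⟨i, h⟩ :=
  Perm.subtypeCongr.apply a b i

theorem sign_oddEvenHom (a : Perm (OddTile n)) (b : Perm (EvenTile n)) :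
    sign (oddEvenHom n (a, b)) = sign a * sign b :=
  sign_subtypeCongr a b

theorem IsTypeI.exists_oddEvenHom_eq {θ : Perm (Fin n)} (h : IsTypeI θ) :
    ∃ a b, oddEvenHom n (a, b) = θ ∧ (∀ x, (a x : Fin n) = θ x) ∧ ∀ x, (b x : Fin n) = θ x := by
  refine ⟨θ.subtypePerm h, θ.subtypePerm fun i => not_congr (h i), ?_, fun _ => rfl,
    fun _ => rfl⟩
  ext i
  rw [oddEvenHom_apply]
  split_ifs <;> rfl

theorem oddEvenHom_mem_altOddEven {a : Perm (OddTile n)} {b : Perm (EvenTile n)}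
    (ha : sign a = 1) (hb : sign b = 1) : oddEvenHom n (a, b) ∈ altOddEven n :=
  ⟨(a, b), ⟨mem_alternatingGroup.2 ha, mem_alternatingGroup.2 hb⟩, rfl⟩

/-- Modulo `A^odd × A^even`, an element of `S^odd × S^even` is determined by its pair of signs. -/
theorem oddEvenHom_mem_of_sign_eq {H : Subgroup (Perm (Fin n))} (hH : altOddEven n ≤ H)
    {a a' : Perm (OddTile n)} {b b' : Perm (EvenTile n)} (h : oddEvenHom n (a, b) ∈ H)
    (ha : sign a' = sign a) (hb : sign b' = sign b) : oddEvenHom n (a', b') ∈ H := by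
  have h' : oddEvenHom n (a' * a⁻¹, b' * b⁻¹) ∈ H :=
    hH (oddEvenHom_mem_altOddEven (by simp [ha]) (by simp [hb]))
  have := H.mul_mem h' h
  rwa [← map_mul, Prod.mk_mul_mk, inv_mul_cancel_right, inv_mul_cancel_right] at this

theorem isTypeII_translation (hn : Even n) : IsTypeII (translation n) := by
  intro i
  obtain ⟨m, rfl⟩ := hn
  have := i.isLt
  simp only [tile, val_translation]
  split_ifs with h
  · rw [Nat.odd_iff, Nat.even_iff]; omega
  · simp only [Nat.odd_iff, Nat.even_iff]; omega

theorem isTypeI_translation_mul_self (hn : Even n) : IsTypeI (translation n * translation n) := by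
  intro i
  have h := isTypeII_translation hn
  rw [Perm.mul_apply, h, ← Nat.not_odd_iff_even, h, Nat.not_even_iff_odd]

theorem isTypeI_flipMove {k : ℕ} (hk : k ≤ n) (hodd : Odd k) : IsTypeI (flipMove n k hk) := by
  intro i
  obtain ⟨m, rfl⟩ := hodd
  simp only [tile, val_flipMove]
  split_ifs
  · simp only [Nat.odd_iff]; omega
  · rfl

/-- `τ` carries each parity class bijectively to the other, so conjugation by it exchanges the two
factors and their signs. -/
theorem translation_conj_oddEvenHom (hn : Even n) (a : Perm (OddTile n)) (b : Perm (EvenTile n)) :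
    ∃ a' b', sign a' = sign b ∧ sign b' = sign a ∧
      translation n * oddEvenHom n (a, b) * (translation n)⁻¹ = oddEvenHom n (a', b') := by
  have h := isTypeII_translation hn
  let e : OddTile n ≃ EvenTile n :=
    (translation n).subtypeEquiv fun i => by rw [h i, Nat.not_even_iff_odd]
  let e' : EvenTile n ≃ OddTile n :=
    (translation n).subtypeEquiv fun i => by rw [h i, Nat.not_odd_iff_even]
  refine ⟨e'.permCongr b, e.permCongr a, sign_permCongr _ _, sign_permCongr _ _, ?_⟩
  rw [mul_inv_eq_iff_eq_mul]
  ext i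
  rw [Perm.mul_apply, Perm.mul_apply, oddEvenHom_apply, oddEvenHom_apply]
  by_cases hi : Odd (tile i)
  · have hi' : ¬ Odd (tile (translation n i)) := by rwa [h i, Nat.not_even_iff_odd]
    rw [dif_pos hi, dif_neg hi']
    have : e.symm ⟨translation n i, hi'⟩ = ⟨i, hi⟩ := (Equiv.symm_apply_eq e).2 rfl
    rw [permCongr_apply, this]
    rfl
  · have hi' : Odd (tile (translation n i)) := by rwa [h i, ← Nat.not_odd_iff_even]
    rw [dif_neg hi, dif_pos hi']
    have : e'.symm ⟨translation n i, hi'⟩ = ⟨i, hi⟩ := (Equiv.symm_apply_eq e').2 rfl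
    rw [permCongr_apply, this]
    rfl

/-- The odd tiles among `2m` tiles, in increasing order. -/
def oddTileEquiv (m : ℕ) : OddTile (2 * m) ≃ Fin m where
  toFun i := ⟨i.1 / 2, by have := i.1.isLt; omega⟩
  invFun j := ⟨⟨2 * j, by omega⟩, j, rfl⟩
  left_inv := by
    rintro ⟨i, l, hl⟩
    unfold tile at hl
    ext
    simp only
    omega
  right_inv j := by ext; simp

/-- The even tiles among `2m` tiles, in increasing order. -/
def evenTileEquiv (m : ℕ) : EvenTile (2 * m) ≃ Fin m where
  toFun i := ⟨i.1 / 2, by have := i.1.isLt; omega⟩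
  invFun j := ⟨⟨2 * j + 1, by omega⟩, by simp only [tile, Nat.odd_iff]; omega⟩
  left_inv := by
    rintro ⟨i, hi⟩
    simp only [tile, Nat.odd_iff] at hi
    ext
    simp only
    omega
  right_inv j := by ext; simp only; omega

theorem val_oddTileEquiv {m : ℕ} (x : OddTile (2 * m)) :
    2 * (oddTileEquiv m x : ℕ) = (x : Fin (2 * m)) := by
  obtain ⟨i, l, hl⟩ := x
  unfold tile at hl
  simp only [oddTileEquiv, coe_fn_mk]
  omega

theorem val_evenTileEquiv {m : ℕ} (x : EvenTile (2 * m)) :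
    2 * (evenTileEquiv m x : ℕ) + 1 = (x : Fin (2 * m)) := by
  obtain ⟨i, hi⟩ := x
  simp only [tile, Nat.odd_iff] at hi
  simp only [evenTileEquiv, coe_fn_mk]
  omega

/-- With each class listed in increasing order, the flip reverses the first `2 * j + 1` odd tiles
and the first `2 * j` even tiles; each reversal consists of `j` transpositions. -/
theorem exists_flipMove_eq_oddEvenHom {m j : ℕ} (hk : 4 * j + 1 ≤ 2 * m) :
    ∃ a b, oddEvenHom (2 * m) (a, b) = flipMove (2 * m) (4 * j + 1) hk ∧
      sign a = (-1) ^ j ∧ sign b = (-1) ^ j := by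
  obtain ⟨a, b, h, ha, hb⟩ := (isTypeI_flipMove hk ⟨2 * j, by ring⟩).exists_oddEvenHom_eq
  refine ⟨a, b, h, ?_, ?_⟩
  · rw [sign_eq_sign_of_equiv a (flipMove m (2 * j + 1) (by omega)) (oddTileEquiv m),
      sign_flipMove]
    · congr 1; omega
    · intro x
      ext
      have h1 := val_oddTileEquiv (a x)
      have h2 := val_oddTileEquiv x
      rw [ha, val_flipMove] at h1
      rw [val_flipMove]
      split_ifs at h1 ⊢ <;> omega
  · rw [sign_eq_sign_of_equiv b (flipMove m (2 * j) (by omega)) (evenTileEquiv m),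
      sign_flipMove]
    · congr 1; omega
    · intro x
      ext
      have h1 := val_evenTileEquiv (b x)
      have h2 := val_evenTileEquiv x
      rw [hb, val_flipMove] at h1
      rw [val_flipMove]
      split_ifs at h1 ⊢ <;> omega

/-- `τ²` rotates each class of `m` tiles by one place. -/
theorem exists_translation_mul_self_eq_oddEvenHom (m : ℕ) :
    ∃ a b, oddEvenHom (2 * m) (a, b) = translation (2 * m) * translation (2 * m) ∧
      sign a = (-1) ^ (m - 1) ∧ sign b = (-1) ^ (m - 1) := by
  obtain ⟨a, b, h, ha, hb⟩ :=
    (isTypeI_translation_mul_self (even_two_mul m)).exists_oddEvenHom_eq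
  refine ⟨a, b, h, ?_, ?_⟩
  · rw [sign_eq_sign_of_equiv a (translation m) (oddTileEquiv m)]
    · exact sign_finRotate m
    · intro x
      ext
      have h1 := val_oddTileEquiv (a x)
      have h2 := val_oddTileEquiv x
      have := (oddTileEquiv m x).isLt
      rw [ha, Perm.mul_apply, val_translation, val_translation] at h1
      rw [val_translation]
      split_ifs at h1 ⊢ <;> omega
  · rw [sign_eq_sign_of_equiv b (translation m) (evenTileEquiv m)]
    · exact sign_finRotate m
    · intro x
      ext
      have h1 := val_evenTileEquiv (b x)
      have h2 := val_evenTileEquiv x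
      have := (evenTileEquiv m x).isLt
      rw [hb, Perm.mul_apply, val_translation, val_translation] at h1
      rw [val_translation]
      split_ifs at h1 ⊢ <;> omega

end Parity

/-! ### The five cases. -/

section Cases

variable {n k : ℕ} {hk : k ≤ n}

theorem eq_top_of_alternatingGroup_le {α : Type*} [Fintype α] [DecidableEq α]
    {H : Subgroup (Perm α)} (hH : alternatingGroup α ≤ H) {g : Perm α} (hg : g ∈ H)
    (hsign : sign g = -1) : H = ⊤ := by
  refine (Subgroup.eq_top_iff' H).2 fun x => ?_
  rcases Int.units_eq_one_or (sign x) with hx | hx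
  · exact hH hx
  · have := H.mul_mem (hH (x := x * g⁻¹) (by simp [mem_alternatingGroup, hx, hsign])) hg
    rwa [inv_mul_cancel_right] at this

theorem ovalTrackGroup_eq_top (hk2 : 2 ≤ k) (h : 2 + k ≤ n)
    (hnk : (Even n ∧ Even k) ∨ (Odd n ∧ (k ≡ 2 [MOD 4] ∨ k ≡ 3 [MOD 4]))) :
    ovalTrackGroup n k hk = ⊤ := by
  rcases hnk with ⟨hn, hk'⟩ | ⟨hn, hk'⟩
  · refine eq_top_of_alternatingGroup_le (alternatingGroup_le_ovalTrackGroup hk2 h (.inr hk'))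
      translation_mem ((sign_finRotate n).trans (Odd.neg_one_pow ?_))
    exact Nat.Even.sub_odd (by omega) hn odd_one
  · refine eq_top_of_alternatingGroup_le (alternatingGroup_le_ovalTrackGroup hk2 h (.inl hn))
      flipMove_mem ((sign_flipMove k hk).trans (Odd.neg_one_pow ?_))
    unfold Nat.ModEq at hk'
    rw [Nat.odd_iff]
    omega

theorem ovalTrackGroup_eq_alternatingGroup (hk2 : 2 ≤ k) (h : 2 + k ≤ n)
    (hnk : Odd n ∧ (k ≡ 0 [MOD 4] ∨ k ≡ 1 [MOD 4])) :
    ovalTrackGroup n k hk = alternatingGroup (Fin n) := by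
  obtain ⟨hn, hk'⟩ := hnk
  refine le_antisymm ?_ (alternatingGroup_le_ovalTrackGroup hk2 h (.inl hn))
  rw [ovalTrackGroup, Subgroup.closure_le]
  rintro _ (rfl | rfl)
  · exact (sign_finRotate n).trans (Even.neg_one_pow (Nat.Odd.sub_odd hn odd_one))
  · refine (sign_flipMove k hk).trans (Even.neg_one_pow ?_)
    unfold Nat.ModEq at hk'
    rw [Nat.even_iff]
    omega

theorem ovalTrackGroup_eq_paritySubgroup (hk2 : 2 ≤ k) (h : 2 + k ≤ n)
    (hn : Even n) (hk' : k ≡ 3 [MOD 4]) : ovalTrackGroup n k hk = paritySubgroup n := by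
  unfold Nat.ModEq at hk'
  have hφI : IsTypeI (flipMove n k hk) := isTypeI_flipMove hk (by rw [Nat.odd_iff]; omega)
  apply le_antisymm
  · rw [ovalTrackGroup, Subgroup.closure_le]
    rintro _ (rfl | rfl)
    · exact .inr (isTypeII_translation hn)
    · exact .inl hφI
  have hA := altOddEven_le_ovalTrackGroup (hk := hk) hk2 h
  have hI : ∀ θ, IsTypeI θ → θ ∈ ovalTrackGroup n k hk := by
    intro θ hθ
    obtain ⟨a, b, rfl, -⟩ := hθ.exists_oddEvenHom_eq
    obtain ⟨a₀, b₀, h₀, -⟩ := hφI.exists_oddEvenHom_eq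
    -- As `k / 2` is odd, `φ` is odd, so its signs on the two classes differ.
    have hs : sign a₀ * sign b₀ = -1 := by
      rw [← sign_oddEvenHom, h₀, sign_flipMove]
      exact Odd.neg_one_pow (by rw [Nat.odd_iff]; omega)
    have hm₀ : oddEvenHom n (a₀, b₀) ∈ ovalTrackGroup n k hk := h₀ ▸ flipMove_mem
    obtain ⟨a₁, b₁, ha₁, hb₁, h₁⟩ := translation_conj_oddEvenHom hn a₀ b₀
    have hm₁ : oddEvenHom n (a₁, b₁) ∈ ovalTrackGroup n k hk :=
      h₁ ▸ Subgroup.mul_mem _ (Subgroup.mul_mem _ translation_mem hm₀)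
        (Subgroup.inv_mem _ translation_mem)
    have hm₂ := Subgroup.mul_mem _ hm₀ hm₁
    rw [← map_mul, Prod.mk_mul_mk] at hm₂
    have hm₃ := Subgroup.one_mem (ovalTrackGroup n k hk)
    rw [← map_one (oddEvenHom n)] at hm₃
    have hsa := Int.units_eq_one_or (sign a)
    have hsb := Int.units_eq_one_or (sign b)
    have hcases : (sign a₀ = 1 ∧ sign b₀ = -1) ∨ (sign a₀ = -1 ∧ sign b₀ = 1) := by
      rcases Int.units_eq_one_or (sign a₀) with h | h
      · exact .inl ⟨h, by simpa [h] using hs⟩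
      · exact .inr ⟨h, by simpa [h] using hs⟩
    -- `φ`, its conjugate by `τ`, their product and the identity realise all four pairs of signs.
    rcases hcases with ⟨ha₀, hb₀⟩ | ⟨ha₀, hb₀⟩ <;> rcases hsa with ha | ha <;>
      rcases hsb with hb | hb <;>
      first
      | exact oddEvenHom_mem_of_sign_eq hA hm₀ (ha.trans ha₀.symm) (hb.trans hb₀.symm)
      | (refine oddEvenHom_mem_of_sign_eq hA hm₁ ?_ ?_ <;> simp [*]; done)
      | (refine oddEvenHom_mem_of_sign_eq hA hm₂ ?_ ?_ <;> simp [*]; done)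
      | (refine oddEvenHom_mem_of_sign_eq hA hm₃ ?_ ?_ <;> simp [*])
  rintro θ (hθ | hθ)
  · exact hI θ hθ
  · have hτ := isTypeII_translation hn
    have := hI (translation n * θ) fun i => by
      rw [Perm.mul_apply, hτ, ← Nat.not_odd_iff_even, hθ, Nat.not_even_iff_odd]
    exact (Subgroup.mul_mem_cancel_left _ translation_mem).1 this

theorem ovalTrackGroup_eq_symOddEven_coset (hk2 : 2 ≤ k) (h : 2 + k ≤ n)
    (hnk : (Even n ∧ k ≡ 5 [MOD 8]) ∨ (n ≡ 0 [MOD 4] ∧ k ≡ 1 [MOD 8])) :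
    (ovalTrackGroup n k hk : Set (Perm (Fin n))) =
      {θ | ∃ α ∈ symOddEven n ⊓ alternatingGroup (Fin n), θ = α ∨ θ = translation n * α} := by
  unfold Nat.ModEq at hnk
  obtain ⟨m, rfl⟩ : ∃ m, n = 2 * m := by
    rcases hnk with ⟨⟨m, hm⟩, -⟩ | ⟨hm, -⟩
    · exact ⟨m, by omega⟩
    · exact ⟨n / 2, by omega⟩
  obtain ⟨j, rfl⟩ : ∃ j, k = 4 * j + 1 := ⟨k / 4, by omega⟩
  obtain ⟨a, b, hab, ha, hb⟩ := exists_flipMove_eq_oddEvenHom hk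
  obtain ⟨c, d, hcd, hc, hd⟩ := exists_translation_mul_self_eq_oddEvenHom m
  have mem : ∀ (a : Perm (OddTile (2 * m))) (b : Perm (EvenTile (2 * m))),
      oddEvenHom (2 * m) (a, b) ∈ symOddEven (2 * m) ⊓ alternatingGroup (Fin (2 * m)) ↔
        sign a = sign b := by
    intro a b
    rw [Subgroup.mem_inf, mem_alternatingGroup, sign_oddEvenHom, mul_eq_one_iff_eq_inv,
      Int.units_inv_eq_self]
    exact and_iff_right ⟨_, rfl⟩
  refine closure_pair_eq_union_coset ?_ ?_ ?_ ?_
  · rintro _ hα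
    obtain ⟨⟨⟨a, b⟩, rfl⟩, -⟩ := id hα
    obtain ⟨a', b', ha', hb', h'⟩ := translation_conj_oddEvenHom (even_two_mul m) a b
    rw [h', mem, ha', hb', (mem a b).1 hα]
  · rw [← hcd, mem, hc, hd]
  · rw [← hab, mem, ha, hb]
  · rintro _ hα
    obtain ⟨⟨⟨a', b'⟩, rfl⟩, -⟩ := id hα
    have hs := (mem a' b').1 hα
    change _ ∈ ovalTrackGroup (2 * m) (4 * j + 1) hk
    have hA := altOddEven_le_ovalTrackGroup (hk := hk) hk2 h
    rcases Int.units_eq_one_or (sign a') with h1 | h1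
    · exact hA (oddEvenHom_mem_altOddEven h1 (hs.symm.trans h1))
    -- The sign pair `(-1, -1)` must come from a generator: from `φ` if `j` is odd. If `j` is even,
    -- then `k ≡ 1 [MOD 8]`, so `n ≡ 0 [MOD 4]` and `τ²` provides it.
    rcases Nat.even_or_odd j with hj | hj
    · have hm : Odd (m - 1) := by rw [Nat.even_iff] at hj; rw [Nat.odd_iff]; omega
      refine oddEvenHom_mem_of_sign_eq hA (a := c) (b := d) ?_ ?_ ?_
      · rw [hcd]; exact Subgroup.mul_mem _ translation_mem translation_mem
      · rw [h1, hc, hm.neg_one_pow]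
      · rw [← hs, h1, hd, hm.neg_one_pow]
    · refine oddEvenHom_mem_of_sign_eq hA (a := a) (b := b) ?_ ?_ ?_
      · rw [hab]; exact flipMove_mem
      · rw [h1, ha, hj.neg_one_pow]
      · rw [← hs, h1, hb, hj.neg_one_pow]

theorem ovalTrackGroup_eq_altOddEven_coset (hk2 : 2 ≤ k) (h : 2 + k ≤ n)
    (hn : n ≡ 2 [MOD 4]) (hk' : k ≡ 1 [MOD 8]) :
    (ovalTrackGroup n k hk : Set (Perm (Fin n))) =
      {θ | ∃ α ∈ altOddEven n, θ = α ∨ θ = translation n * α} := by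
  unfold Nat.ModEq at hn hk'
  obtain ⟨m, rfl⟩ : ∃ m, n = 2 * m := ⟨n / 2, by omega⟩
  obtain ⟨j, rfl⟩ : ∃ j, k = 4 * j + 1 := ⟨k / 4, by omega⟩
  obtain ⟨a, b, hab, ha, hb⟩ := exists_flipMove_eq_oddEvenHom hk
  obtain ⟨c, d, hcd, hc, hd⟩ := exists_translation_mul_self_eq_oddEvenHom m
  -- Both exponents are even, so `φ` and `τ²` already lie in `A^odd × A^even`.
  have hj : Even j := by rw [Nat.even_iff]; omega
  have hm : Even (m - 1) := by rw [Nat.even_iff]; omega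
  refine closure_pair_eq_union_coset ?_ ?_ ?_ (altOddEven_le_ovalTrackGroup (hk := hk) hk2 h)
  · rintro _ ⟨⟨a, b⟩, ⟨ha, hb⟩, rfl⟩
    obtain ⟨a', b', ha', hb', h'⟩ := translation_conj_oddEvenHom (even_two_mul m) a b
    rw [h']
    exact oddEvenHom_mem_altOddEven (ha'.trans hb) (hb'.trans ha)
  · exact hcd ▸ oddEvenHom_mem_altOddEven (hc.trans hm.neg_one_pow) (hd.trans hm.neg_one_pow)
  · exact hab ▸ oddEvenHom_mem_altOddEven (ha.trans hj.neg_one_pow) (hb.trans hj.neg_one_pow)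

end Cases

end OvalTrack

theorem mainTheorem1 (n k : ℕ) (hn : 4 ≤ n) (hk : 1 < k) (hkn : k < n - 1) :
    ((Even n ∧ Even k) ∨ (Odd n ∧ (k ≡ 2 [MOD 4] ∨ k ≡ 3 [MOD 4])) →
      ovalTrackGroup n k (hkn.le.trans (Nat.sub_le n 1)) = ⊤) ∧
    (Odd n ∧ (k ≡ 0 [MOD 4] ∨ k ≡ 1 [MOD 4]) →
      ovalTrackGroup n k (hkn.le.trans (Nat.sub_le n 1)) = alternatingGroup (Fin n)) ∧
    (Even n ∧ k ≡ 3 [MOD 4] →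
      ovalTrackGroup n k (hkn.le.trans (Nat.sub_le n 1)) = paritySubgroup n) ∧
    ((Even n ∧ k ≡ 5 [MOD 8]) ∨ (n ≡ 0 [MOD 4] ∧ k ≡ 1 [MOD 8]) →
      (ovalTrackGroup n k (hkn.le.trans (Nat.sub_le n 1)) : Set (Equiv.Perm (Fin n))) =
        {θ | ∃ α ∈ symOddEven n ⊓ alternatingGroup (Fin n),
          θ = α ∨ θ = translation n * α}) ∧
    (n ≡ 2 [MOD 4] ∧ k ≡ 1 [MOD 8] →
      (ovalTrackGroup n k (hkn.le.trans (Nat.sub_le n 1)) : Set (Equiv.Perm (Fin n))) =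
        {θ | ∃ α ∈ altOddEven n, θ = α ∨ θ = translation n * α}) := by
  have h : 2 + k ≤ n := by omega
  exact ⟨ovalTrackGroup_eq_top hk h, ovalTrackGroup_eq_alternatingGroup hk h,
    fun hnk => ovalTrackGroup_eq_paritySubgroup hk h hnk.1 hnk.2,
    ovalTrackGroup_eq_symOddEven_coset hk h,
    fun hnk => ovalTrackGroup_eq_altOddEven_coset hk h hnk.1 hnk.2⟩
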